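/- Let $\mathbb{S}$ be the set of all strictly decreasing sequences $s=\langle s_n : n\ge 1\rangle$ of positive reals converging to $0$. For $s\in\mathbb{S}$ let $s^*=\{\langle s_{kn}:n\ge1\rangle : k\ge 1\}$ be the set of all multiplicative shifts of $s$. For $S\subseteq\mathbb{S}$ let $\mathcal{D}(S)$ be the family of all sets $E\subseteq\mathbb{R}$ such that for every $t\in S$ there is a sequence $\langle E_n : n\ge1\rangle$ of subsets of $\mathbb{R}$ with $E\subseteq\bigcup_{n\ge1}E_n$ and $\operatorname{diam}E_n<t_n$ for all $n$. For real $\alpha\ge0$ let $\mathrm{HD}(\alpha)$ be the family of all $E\subseteq\mathbb{R}$ of Hausdorff dimension at most $\alpha$. Then: (i) For every $s\in\mathbb{S}$ and every real $\alpha$ with $0\le\alpha<1$, $\mathrm{HD}(\alpha)\neq\mathcal{D}(s^*)$. (ii) For every $s\in\mathbb{S}$, $\mathrm{HD}(1)\neq\mathcal{D}(s^*)$ if and only if $s\in\ell^1$, that is, $\sum_{n\ge1}s_n<\infty$. -/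

import Mathlib

open Set Filter Topology
open scoped NNReal ENNReal

namespace Dominated

/-- The family `𝕊` of all strictly decreasing sequences of positive reals, indexed by the positive
integers, that converge to `0`. -/
def decSeq : Set (ℕ+ → ℝ) :=
  {s | StrictAnti s ∧ (∀ n, 0 < s n) ∧ Tendsto s atTop (𝓝 0)}

/-- The multiplicative `k`-shift `⟨s_{kn} : n ∈ ℕ₊⟩` of a sequence `s`. -/
def mulShift (s : ℕ+ → ℝ) (k : ℕ+) : ℕ+ → ℝ := fun n => s (k * n)

/-- The closure `S*` of a family of sequences: all multiplicative shifts of its members. -/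
def mulClosure (S : Set (ℕ+ → ℝ)) : Set (ℕ+ → ℝ) :=
  {t | ∃ s ∈ S, ∃ k : ℕ+, t = mulShift s k}

/-- A sequence of sets is `s`-fine if `diam Eₙ < sₙ` for all `n`; the diameter is the extended
one, so that unbounded sets have infinite diameter. -/
def IsFine {X : Type*} [MetricSpace X] (s : ℕ+ → ℝ) (E : ℕ+ → Set X) : Prop :=
  ∀ n, Metric.ediam (E n) < ENNReal.ofReal (s n)

/-- `A` is `S`-dominated if for each `s ∈ S` there is an `s`-fine cover of `A`. -/
def IsDominated {X : Type*} [MetricSpace X] (S : Set (ℕ+ → ℝ)) (A : Set X) : Prop :=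
  ∀ s ∈ S, ∃ E : ℕ+ → Set X, IsFine s E ∧ A ⊆ ⋃ n, E n

/-- The family `𝒟_X(S)` of all `S`-dominated subsets of `X`. -/
def dominatedSets (X : Type*) [MetricSpace X] (S : Set (ℕ+ → ℝ)) : Set (Set X) :=
  {A | IsDominated S A}

/-- The family of all subsets of the real line of Hausdorff dimension at most `α`. -/
def hausdorffDimLE (α : ℝ≥0) : Set (Set ℝ) := {A | dimH A ≤ (α : ℝ≥0∞)}

end Dominated

/-! Both failures of equality come from Cantor sets made by spreading binary digits. For a unit-step
`a`, the map `spread a` writes the digits of `x` at the places where `a` jumps and zeros elsewhere.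
It matches intervals of length `2 ^ (-a m)` with pieces of size `2 ^ (-m)`, up to constants
(`abs_spread_sub_le`, `abs_sub_le_of_abs_spread_sub_le`). Hence the growth rate of `a` controls the
dimension of the image of `[0, 1)`, and covering the image by sets of size `2 ^ (-m n)` amounts to
covering `[0, 1)` by intervals of length about `2 ^ (-a (m n))`.

Let `α < 1`. If `∑ s n ^ β` diverges for some `β` in `(α, 1]`, take `a m = ⌊β m⌋`: the image has
dimension at least `β`, yet divergence lets every shift of `s` cover it
(`exists_dominated_dimH_gt`). Otherwise all these sums converge, and a diagonal choice of `a` grows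
barely slowly enough for dimension at most `α`, while `∑ 2 ^ (-a (m n))` converges with `2 ^ (-m n)`
comparable to `s n`. A late shift then has too little total length to cover
(`exists_dimH_le_not_dominated`).

For `α = 1` every set has dimension at most `1`, so the question is whether every set is dominated.
Intervals of divergent total length cover the line; those of finite total length do not. -/

namespace Dominated

/-! ### Spreading binary digits -/

/-- A sequence of naturals each of whose steps is `0` or `1`. -/
def UnitSteps (a : ℕ → ℕ) : Prop := ∀ m, a (m + 1) = a m ∨ a (m + 1) = a m + 1

/-- The `m`-th dyadic numerator of the spreading of `x` along `a`: a binary digit of `x` is placed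
where `a` jumps, and a zero elsewhere. -/
noncomputable def spreadNum (a : ℕ → ℕ) (x : ℝ) : ℕ → ℤ
  | 0 => ⌊(2 : ℝ) ^ a 0 * x⌋
  | m + 1 => 2 * spreadNum a x m +
      (⌊(2 : ℝ) ^ a (m + 1) * x⌋ - 2 ^ (a (m + 1) - a m) * ⌊(2 : ℝ) ^ a m * x⌋)

/-- The spreading of `x` along `a`: the limit of the dyadic rationals with numerators
`spreadNum a x`. -/
noncomputable def spread (a : ℕ → ℕ) (x : ℝ) : ℝ := ⨆ m, (spreadNum a x m : ℝ) / 2 ^ m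

section
variable {a : ℕ → ℕ} (ha : UnitSteps a)
include ha

theorem floor_step (x : ℝ) (m : ℕ) :
    a (m + 1) = a m ∧ ⌊(2 : ℝ) ^ a (m + 1) * x⌋ = ⌊(2 : ℝ) ^ a m * x⌋ ∨
    a (m + 1) = a m + 1 ∧ (⌊(2 : ℝ) ^ a (m + 1) * x⌋ = 2 * ⌊(2 : ℝ) ^ a m * x⌋ ∨
      ⌊(2 : ℝ) ^ a (m + 1) * x⌋ = 2 * ⌊(2 : ℝ) ^ a m * x⌋ + 1) := by
  rcases ha m with h | h
  · exact Or.inl ⟨h, by rw [h]⟩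
  · refine Or.inr ⟨h, ?_⟩
    have e : (2 : ℝ) ^ a (m + 1) * x = 2 * (2 ^ a m * x) := by rw [h, pow_succ]; ring
    rw [e]
    generalize (2 : ℝ) ^ a m * x = y
    have h1 : 2 * ⌊y⌋ ≤ ⌊2 * y⌋ := by
      rw [Int.le_floor]; push_cast; linarith [Int.floor_le y]
    have h2 : ⌊2 * y⌋ < 2 * ⌊y⌋ + 2 := by
      rw [Int.floor_lt]; push_cast; linarith [Int.lt_floor_add_one y]
    omega

theorem spreadNum_succ (x : ℝ) (m : ℕ) :
    spreadNum a x (m + 1) = 2 * spreadNum a x m ∨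
    spreadNum a x (m + 1) = 2 * spreadNum a x m + 1 := by
  rcases floor_step ha x m with ⟨h, h'⟩ | ⟨h, h' | h'⟩ <;> rw [h] at h' <;>
    simp only [spreadNum, h, Nat.sub_self, Nat.add_sub_cancel_left, pow_zero, pow_one] <;> omega

/-- The floor at level `m` determines the floors at all earlier levels, hence every digit placed so
far. -/
theorem spreadNum_congr {x y : ℝ} (m : ℕ) (h : ⌊(2 : ℝ) ^ a m * x⌋ = ⌊(2 : ℝ) ^ a m * y⌋) :
    spreadNum a x m = spreadNum a y m := by
  induction m with
  | zero => exact h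
  | succ m ih =>
    have h' : ⌊(2 : ℝ) ^ a m * x⌋ = ⌊(2 : ℝ) ^ a m * y⌋ := by
      have := floor_step ha x m
      have := floor_step ha y m
      omega
    simp [spreadNum, h, h', ih h']

/-- At a jump of `a` both differences double and gain the same digit difference. Elsewhere only the
right one doubles, and it dominates a nonnegative quantity because `x ≤ y`. -/
theorem floor_sub_le_spreadNum_sub {x y : ℝ} (hxy : x ≤ y) (m : ℕ) :
    ⌊(2 : ℝ) ^ a m * y⌋ - ⌊(2 : ℝ) ^ a m * x⌋ ≤ spreadNum a y m - spreadNum a x m := by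
  induction m with
  | zero => exact le_rfl
  | succ m ih =>
    have hm : ⌊(2 : ℝ) ^ a m * x⌋ ≤ ⌊(2 : ℝ) ^ a m * y⌋ := by gcongr
    rcases ha m with h | h
    · simp only [spreadNum, h, Nat.sub_self, pow_zero]; omega
    · simp only [spreadNum, h, Nat.add_sub_cancel_left, pow_one]; omega

theorem monotone_spreadNum_div (x : ℝ) : Monotone fun m => (spreadNum a x m : ℝ) / 2 ^ m := by
  refine monotone_nat_of_le_succ fun m => ?_
  have h : 2 * spreadNum a x m ≤ spreadNum a x (m + 1) := by
    rcases spreadNum_succ ha x m with h | h <;> omega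
  have h' : 2 * (spreadNum a x m : ℝ) ≤ spreadNum a x (m + 1) := by exact_mod_cast h
  rw [div_le_div_iff₀ (by positivity) (by positivity), pow_succ]
  nlinarith [show (0 : ℝ) < 2 ^ m by positivity]

theorem antitone_spreadNum_add_one_div (x : ℝ) :
    Antitone fun m => ((spreadNum a x m : ℝ) + 1) / 2 ^ m := by
  refine antitone_nat_of_succ_le fun m => ?_
  have h : spreadNum a x (m + 1) ≤ 2 * spreadNum a x m + 1 := by
    rcases spreadNum_succ ha x m with h | h <;> omega
  have h' : (spreadNum a x (m + 1) : ℝ) ≤ 2 * spreadNum a x m + 1 := by exact_mod_cast h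
  rw [div_le_div_iff₀ (by positivity) (by positivity), pow_succ]
  nlinarith [show (0 : ℝ) < 2 ^ m by positivity]

theorem spreadNum_div_le (x : ℝ) (m n : ℕ) :
    (spreadNum a x m : ℝ) / 2 ^ m ≤ ((spreadNum a x n : ℝ) + 1) / 2 ^ n :=
  calc (spreadNum a x m : ℝ) / 2 ^ m ≤ (spreadNum a x (max m n) : ℝ) / 2 ^ (max m n) :=
        monotone_spreadNum_div ha x (le_max_left _ _)
    _ ≤ ((spreadNum a x (max m n) : ℝ) + 1) / 2 ^ (max m n) := by gcongr; linarith
    _ ≤ _ := antitone_spreadNum_add_one_div ha x (le_max_right _ _)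

theorem spreadNum_le_mul_spread (x : ℝ) (m : ℕ) : (spreadNum a x m : ℝ) ≤ spread a x * 2 ^ m := by
  rw [← div_le_iff₀ (by positivity)]
  exact le_ciSup (f := fun m => (spreadNum a x m : ℝ) / 2 ^ m)
    ⟨_, forall_mem_range.2 fun k => spreadNum_div_le ha x k 0⟩ m

theorem mul_spread_le_spreadNum (x : ℝ) (m : ℕ) :
    spread a x * 2 ^ m ≤ (spreadNum a x m : ℝ) + 1 := by
  rw [← le_div_iff₀ (by positivity)]
  exact ciSup_le fun k => spreadNum_div_le ha x k m

/-- Points in the same dyadic interval of length `2 ^ (-a m)` are spread at most `2 ^ (-m)` apart. -/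
theorem abs_spread_sub_le {x y : ℝ} (m : ℕ) (h : ⌊(2 : ℝ) ^ a m * x⌋ = ⌊(2 : ℝ) ^ a m * y⌋) :
    |spread a x - spread a y| ≤ ((2 : ℝ) ^ m)⁻¹ := by
  have hk : (spreadNum a x m : ℝ) = spreadNum a y m := by rw [spreadNum_congr ha m h]
  have hp : (0 : ℝ) < 2 ^ m := by positivity
  rw [← one_div, le_div_iff₀ hp, ← abs_of_pos hp, ← abs_mul, sub_mul, abs_le]
  constructor <;>
  linarith [spreadNum_le_mul_spread ha x m, mul_spread_le_spreadNum ha x m,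
    spreadNum_le_mul_spread ha y m, mul_spread_le_spreadNum ha y m]

/-- Points spread at most `2 ^ (-m)` apart are at distance at most `3 * 2 ^ (-a m)`. -/
theorem abs_sub_le_of_abs_spread_sub_le {x y : ℝ} (m : ℕ)
    (h : |spread a x - spread a y| ≤ ((2 : ℝ) ^ m)⁻¹) : |x - y| ≤ 3 * ((2 : ℝ) ^ a m)⁻¹ := by
  wlog hxy : x ≤ y generalizing x y
  · rw [abs_sub_comm]
    exact this (by rwa [abs_sub_comm]) (le_of_not_ge hxy)
  have hp : (0 : ℝ) < 2 ^ m := by positivity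
  have h1 : spread a y * 2 ^ m ≤ spread a x * 2 ^ m + 1 := by
    have h2 := mul_le_mul_of_nonneg_right ((neg_le_of_abs_le h)) hp.le
    rw [neg_mul, inv_mul_cancel₀ hp.ne'] at h2
    linarith
  -- One unit comes from the distance of the spread points, one from truncating `spread a x`.
  -- Truncating `2 ^ a m * y` gives the third unit of the constant `3`.
  have h2 : (spreadNum a y m : ℝ) ≤ spreadNum a x m + 2 := by
    linarith [spreadNum_le_mul_spread ha y m, mul_spread_le_spreadNum ha x m]
  have h3 : (⌊(2 : ℝ) ^ a m * y⌋ - ⌊(2 : ℝ) ^ a m * x⌋ : ℝ) ≤ spreadNum a y m - spreadNum a x m := by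
    exact_mod_cast floor_sub_le_spreadNum_sub ha hxy m
  have hq : (0 : ℝ) < 2 ^ a m := by positivity
  rw [abs_sub_comm, abs_of_nonneg (by linarith), ← div_eq_mul_inv, le_div_iff₀ hq]
  linarith [Int.floor_le ((2 : ℝ) ^ a m * x), Int.lt_floor_add_one ((2 : ℝ) ^ a m * y)]

end

theorem unitSteps_floor {b : ℕ → ℝ} (h0 : 0 ≤ b 0) (h : ∀ m, b m ≤ b (m + 1))
    (h' : ∀ m, b (m + 1) ≤ b m + 1) : UnitSteps fun m => ⌊b m⌋₊ := by
  intro m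
  have hb : 0 ≤ b m := h0.trans (monotone_nat_of_le_succ h (Nat.zero_le m))
  have h1 : ⌊b m⌋₊ ≤ ⌊b (m + 1)⌋₊ := Nat.floor_mono (h m)
  have h2 : ⌊b (m + 1)⌋₊ ≤ ⌊b m⌋₊ + 1 := by
    rw [← Nat.floor_add_one hb]; exact Nat.floor_mono (h' m)
  simp only
  omega

/-! ### Hausdorff dimension of spread sets -/

/-- If `a m ≤ δ m + C` for some `δ < γ`, the spread unit interval has dimension at most `γ`. -/
theorem dimH_spread_le {a : ℕ → ℕ} (ha : UnitSteps a) {γ : ℝ≥0} {δ C : ℝ} (hδ : δ < γ)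
    (h : ∀ m, (a m : ℝ) ≤ δ * m + C) : dimH (spread a '' Ico 0 1) ≤ γ := by
  borelize ℝ
  apply dimH_le_of_hausdorffMeasure_ne_top
  -- The images of the `2 ^ a m` dyadic cells of `[0, 1)`. Their `γ`-sum is at most `2 ^ (a m - γ m)
  -- ≤ 2 ^ C` at every level.
  set t : ∀ m : ℕ, Fin (2 ^ a m) → Set ℝ :=
    fun m i => spread a '' {x | ⌊(2 : ℝ) ^ a m * x⌋ = (i : ℕ)} with ht
  have hdiam : ∀ m i, Metric.ediam (t m i) ≤ ENNReal.ofReal ((2 : ℝ) ^ m)⁻¹ := by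
    intro m i
    apply Metric.ediam_le
    rintro _ ⟨x, hx, rfl⟩ _ ⟨y, hy, rfl⟩
    rw [edist_dist, Real.dist_eq]
    exact ENNReal.ofReal_le_ofReal (abs_spread_sub_le ha m (hx.trans hy.symm))
  have key := MeasureTheory.Measure.hausdorffMeasure_le_liminf_sum (γ : ℝ) (spread a '' Ico 0 1)
    (l := atTop) (fun m : ℕ => ENNReal.ofReal ((2 : ℝ) ^ m)⁻¹) (by
      rw [← ENNReal.ofReal_zero]
      refine ENNReal.tendsto_ofReal ?_
      simp_rw [← inv_pow]
      exact tendsto_pow_atTop_nhds_zero_of_lt_one (by norm_num) (by norm_num)) t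
    (Eventually.of_forall hdiam) (Eventually.of_forall fun m => by
      rintro _ ⟨x, ⟨hx0, hx1⟩, rfl⟩
      have h0 : 0 ≤ ⌊(2 : ℝ) ^ a m * x⌋ := Int.floor_nonneg.2 (by positivity)
      have h1 : ⌊(2 : ℝ) ^ a m * x⌋ < ((2 ^ a m : ℕ) : ℤ) := by
        rw [Int.floor_lt]; push_cast; nlinarith [show (0 : ℝ) < 2 ^ a m by positivity]
      refine mem_iUnion.2 ⟨⟨(⌊(2 : ℝ) ^ a m * x⌋).toNat, by omega⟩, x, ?_, rfl⟩
      simp [h0])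
  refine ne_top_of_le_ne_top (b := ENNReal.ofReal (2 ^ C)) ENNReal.ofReal_ne_top (key.trans ?_)
  refine liminf_le_of_le (by isBoundedDefault) fun c hc => ?_
  obtain ⟨m, hm⟩ := hc.exists
  refine hm.trans ?_
  calc ∑ i, Metric.ediam (t m i) ^ (γ : ℝ)
      ≤ ∑ i : Fin (2 ^ a m), ENNReal.ofReal ((2 : ℝ) ^ m)⁻¹ ^ (γ : ℝ) :=
        Finset.sum_le_sum fun i _ => ENNReal.rpow_le_rpow (hdiam m i) γ.coe_nonneg
    _ = ENNReal.ofReal (2 ^ (a m : ℝ) * 2 ^ (-(γ * m : ℝ))) := by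
        rw [Finset.sum_const, Finset.card_univ, Fintype.card_fin, nsmul_eq_mul,
          ENNReal.ofReal_rpow_of_nonneg (by positivity) γ.coe_nonneg, ENNReal.ofReal_mul (by positivity)]
        congr 2
        · rw [Real.rpow_natCast, ENNReal.ofReal_pow (by norm_num)]; simp
        · rw [← Real.rpow_natCast, ← Real.rpow_neg (by norm_num), ← Real.rpow_mul (by norm_num)]
          congr 1; ring
    _ ≤ _ := by
        rw [← Real.rpow_add (by norm_num)]
        refine ENNReal.ofReal_le_ofReal (Real.rpow_le_rpow_of_exponent_le (by norm_num) ?_)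
        nlinarith [h m, Nat.cast_nonneg (α := ℝ) m]

/-- If `β m ≤ a m + 1`, the spread unit interval has dimension at least `β`. -/
theorem le_dimH_spread {a : ℕ → ℕ} (ha : UnitSteps a) (ha0 : a 0 = 0) {β : ℝ≥0} (hβ : 0 < β)
    (h : ∀ m : ℕ, β * (m : ℝ) ≤ a m + 1) : (β : ℝ≥0∞) ≤ dimH (spread a '' Ico 0 1) := by
  have hβ' : (0 : ℝ) < β := hβ
  -- The `+ 1` in `h` costs a factor `2`, whence `6 = 3 * 2`.
  have hpow : ∀ m, 3 * ((2 : ℝ) ^ a m)⁻¹ ≤ 6 * (((2 : ℝ) ^ m)⁻¹) ^ (β : ℝ) := by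
    intro m
    have : ((2 : ℝ) ^ a m)⁻¹ ≤ 2 * (((2 : ℝ) ^ m)⁻¹) ^ (β : ℝ) := by
      rw [← Real.rpow_natCast, ← Real.rpow_natCast, ← Real.rpow_neg (by norm_num),
        ← Real.rpow_neg (by norm_num), ← Real.rpow_mul (by norm_num)]
      nth_rw 2 [← Real.rpow_one 2]
      rw [← Real.rpow_add (by norm_num)]
      exact Real.rpow_le_rpow_of_exponent_le (by norm_num) (by nlinarith [h m])
    linarith
  have hspread : ∀ x ∈ Ico (0 : ℝ) 1, 0 ≤ spread a x ∧ spread a x ≤ 1 := by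
    intro x hx
    have h0 : spreadNum a x 0 = 0 := by
      simp only [spreadNum, ha0, pow_zero, one_mul]
      exact Int.floor_eq_zero_iff.2 hx
    have h1 := spreadNum_le_mul_spread ha x 0
    have h2 := mul_spread_le_spreadNum ha x 0
    simp only [h0] at h1 h2
    norm_num at h1 h2
    exact ⟨h1, h2⟩
  have hinj : ∀ x y, spread a x = spread a y → x = y := by
    intro x y hxy
    have hle : |x - y| ≤ 0 := by
      refine ge_of_tendsto' (x := atTop)
        (f := fun m : ℕ => 6 * (((2 : ℝ) ^ m)⁻¹) ^ (β : ℝ)) ?_ fun m =>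
        (abs_sub_le_of_abs_spread_sub_le ha m (by rw [hxy, sub_self, abs_zero]; positivity)).trans
          (hpow m)
      have := ((tendsto_pow_atTop_nhds_zero_of_lt_one (r := (2 : ℝ)⁻¹) (by norm_num)
        (by norm_num)).rpow_const (Or.inr hβ'.le)).const_mul 6
      simpa [Real.zero_rpow hβ'.ne'] using this
    exact sub_eq_zero.1 (abs_nonpos_iff.1 hle)
  -- The inverse of the spreading is `β`-Hölder, so its image `[0, 1)`, of dimension `1`, forces
  -- dimension at least `β` on its domain. The inner factor `2` is the loss in replacing the
  -- distance by a power `2 ^ (-m)`.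
  have hhol : ∀ x ∈ Ico (0 : ℝ) 1, ∀ y ∈ Ico (0 : ℝ) 1,
      |x - y| ≤ 6 * (2 * |spread a x - spread a y|) ^ (β : ℝ) := by
    intro x hx y hy
    rcases eq_or_ne (spread a x) (spread a y) with e | e
    · rw [hinj x y e, sub_self, abs_zero]; positivity
    have hpos : 0 < |spread a x - spread a y| := abs_pos.2 (sub_ne_zero.2 e)
    have hle : |spread a x - spread a y| ≤ 1 := by
      have := hspread x hx; have := hspread y hy; rw [abs_le]; constructor <;> linarith
    obtain ⟨m, hm1, hm2⟩ := exists_nat_pow_near_of_lt_one hpos hle (y := (2 : ℝ)⁻¹)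
      (by norm_num) (by norm_num)
    rw [inv_pow] at hm1 hm2
    refine (abs_sub_le_of_abs_spread_sub_le ha m hm2).trans ((hpow m).trans ?_)
    gcongr
    rw [pow_succ, mul_inv] at hm1
    linarith
  set ψ := Function.invFunOn (spread a) (Ico 0 1)
  have hψ1 : ∀ x ∈ Ico (0 : ℝ) 1, ψ (spread a x) = x := fun x hx =>
    hinj _ _ (Function.invFunOn_eq ⟨x, hx, rfl⟩)
  have hH : HolderOnWith (6 * 2 ^ (β : ℝ)) β ψ (spread a '' Ico 0 1) := by
    rintro _ ⟨x, hx, rfl⟩ _ ⟨y, hy, rfl⟩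
    rw [hψ1 x hx, hψ1 y hy, edist_nndist, edist_nndist, ← ENNReal.coe_rpow_of_nonneg _ β.coe_nonneg,
      ← ENNReal.coe_mul, ENNReal.coe_le_coe, ← NNReal.coe_le_coe]
    push_cast
    rw [Real.dist_eq, Real.dist_eq, mul_assoc, ← Real.mul_rpow (by norm_num) (abs_nonneg _)]
    exact hhol x hx y hy
  have him : ψ '' (spread a '' Ico 0 1) = Ico 0 1 := by
    rw [image_image, image_congr hψ1, image_id']
  have hdim := hH.dimH_image_le hβ
  rw [him, Real.dimH_of_nonempty_interior (by rw [interior_Ico]; exact nonempty_Ioo.2 one_pos),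
    Module.finrank_self, ENNReal.le_div_iff_mul_le (Or.inl (by simpa using hβ.ne'))
      (Or.inl ENNReal.coe_ne_top)] at hdim
  simpa using hdim

/-! ### Multiplicative shifts, and domination of the whole line -/

theorem mulShift_mem_decSeq {s : ℕ+ → ℝ} (hs : s ∈ decSeq) (k : ℕ+) : mulShift s k ∈ decSeq := by
  refine ⟨fun m n h => hs.1 (mul_lt_mul_right h k), fun n => hs.2.1 _, hs.2.2.comp ?_⟩
  exact tendsto_atTop_mono (fun n => PNat.coe_le_coe _ _ |>.1
    (by simpa using Nat.le_mul_of_pos_left (n : ℕ) k.pos)) tendsto_id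

theorem mulShift_mul (s : ℕ+ → ℝ) (k l n : ℕ+) :
    mulShift s k (l * n) = mulShift s (k * l) n :=
  congrArg s (mul_assoc k l n).symm

theorem mulShift_mem_mulClosure (s : ℕ+ → ℝ) (k : ℕ+) : mulShift s k ∈ mulClosure {s} :=
  ⟨s, rfl, k, rfl⟩

theorem summable_pnat_iff_summable_succPNat {f : ℕ+ → ℝ} :
    Summable f ↔ Summable fun n : ℕ => f n.succPNat :=
  (Equiv.pnatEquivNat.symm.summable_iff (f := f)).symm

/-- An antitone nonnegative sequence is summable if one of its multiplicative shifts is. -/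
theorem summable_of_summable_mul {f : ℕ+ → ℝ} (hf : Antitone f) (h0 : ∀ n, 0 ≤ f n) (k : ℕ+)
    (h : Summable fun n => f (k * n)) : Summable f := by
  have : NeZero (k : ℕ) := ⟨k.ne_zero⟩
  rw [summable_pnat_iff_summable_succPNat] at h ⊢
  -- With the first `k` terms dropped, the `q`-th block of `k` terms starts at index `k * (q + 1) +
  -- 1`, so each of its terms is at most `f (k * (q + 1))`.
  rw [← summable_nat_add_iff (k : ℕ), ← (Nat.divModEquiv (k : ℕ)).symm.summable_iff]
  refine Summable.of_nonneg_of_le (f := fun p : ℕ × Fin k => f (k * p.1.succPNat))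
    (fun _ => h0 _) (fun p => ?_) ?_
  · refine hf ?_
    rw [← PNat.coe_le_coe]
    simp [Nat.divModEquiv]
    nlinarith
  · rw [summable_prod_of_nonneg (fun _ => h0 _)]
    exact ⟨fun _ => Summable.of_finite, by simpa using h.mul_left (k : ℝ)⟩

theorem exists_mem_Ico_sum_range {u : ℕ → ℝ} (hu : ∀ n, 0 ≤ u n) (h : ¬ Summable u) {x : ℝ}
    (hx : 0 ≤ x) :
    ∃ n, x ∈ Ico (∑ i ∈ Finset.range n, u i) (∑ i ∈ Finset.range (n + 1), u i) := by
  classical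
  have hex : ∃ n, x < ∑ i ∈ Finset.range n, u i :=
    (((not_summable_iff_tendsto_nat_atTop_of_nonneg hu).1 h).eventually_gt_atTop x).exists
  have hne : Nat.find hex ≠ 0 := fun h0 => by
    have := Nat.find_spec hex
    rw [h0, Finset.sum_range_zero] at this
    linarith
  obtain ⟨n, hn⟩ := Nat.exists_eq_succ_of_ne_zero hne
  exact ⟨n, not_lt.1 (Nat.find_min hex (by omega)), by simpa [hn] using Nat.find_spec hex⟩

theorem ediam_lt_ofReal {E : Set ℝ} {r t : ℝ} (ht : 0 < t) (hrt : r < t)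
    (h : ∀ x ∈ E, ∀ y ∈ E, |x - y| ≤ r) : Metric.ediam E < ENNReal.ofReal t := by
  refine (Metric.ediam_le fun x hx y hy => ?_).trans_lt
    ((ENNReal.ofReal_lt_ofReal_iff ht).2 hrt)
  rw [edist_dist, Real.dist_eq]
  exact ENNReal.ofReal_le_ofReal (h x hx y hy)

theorem exists_fine_cover_Ici {t : ℕ+ → ℝ} (ht : t ∈ decSeq) (h : ¬ Summable t) :
    ∃ E : ℕ+ → Set ℝ, IsFine t E ∧ Ici 0 ⊆ ⋃ n, E n := by
  -- Halving makes the diameter bound strict and preserves divergence.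
  set u : ℕ → ℝ := fun n => t n.succPNat / 2 with hu
  have hpos : ∀ n, 0 < u n := fun n => half_pos (ht.2.1 _)
  have hns : ¬ Summable u := by
    rwa [hu, summable_div_const_iff two_ne_zero, ← summable_pnat_iff_summable_succPNat]
  set q : ℕ → ℝ := fun n => ∑ i ∈ Finset.range n, u i with hq
  refine ⟨fun n => Ico (q n.natPred) (q (n.natPred + 1)), fun n => ?_, fun x hx => ?_⟩
  · refine ediam_lt_ofReal (r := u n.natPred) (ht.2.1 n) ?_ fun x hx y hy => ?_
    · have := ht.2.1 n
      simp only [hu, PNat.succPNat_natPred]; linarith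
    · simp only [hq, Finset.sum_range_succ, mem_Ico] at hx hy
      rw [abs_le]; constructor <;> linarith
  · obtain ⟨n, hn⟩ := exists_mem_Ico_sum_range (fun n => (hpos n).le) hns hx
    exact mem_iUnion.2 ⟨n.succPNat, by simpa using hn⟩

/-- Covers fine for the shift by `k * 2` can be interleaved into one for the shift by `k`: the cover
of `A` fills the places `2 * j`, that of `B` the places `2 * j - 1`, where the bound is only larger.
-/
theorem IsDominated.union {s : ℕ+ → ℝ} (hs : s ∈ decSeq) {A B : Set ℝ}
    (hA : IsDominated (mulClosure {s}) A) (hB : IsDominated (mulClosure {s}) B) :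
    IsDominated (mulClosure {s}) (A ∪ B) := by
  rintro _ ⟨_, rfl, k, rfl⟩
  obtain ⟨E, hE, hAE⟩ := hA _ (mulShift_mem_mulClosure _ (k * 2))
  obtain ⟨F, hF, hBF⟩ := hB _ (mulShift_mem_mulClosure _ (k * 2))
  refine ⟨fun n => {x | (∃ j, n = 2 * j ∧ x ∈ E j) ∨ ∃ j, n + 1 = 2 * j ∧ x ∈ F j}, fun n => ?_, ?_⟩
  · have hcoe : ∀ m j : ℕ+, m = 2 * j ↔ (m : ℕ) = 2 * j := fun m j => by
      rw [← PNat.coe_inj]; simp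
    have hn := n.pos
    rcases Nat.even_or_odd' n with ⟨c, hc | hc⟩
    · lift c to ℕ+ using by omega
      have hnc : n = 2 * c := (hcoe _ _).2 hc
      refine (Metric.ediam_mono (t := E c) ?_).trans_lt ((hE c).trans_le ?_)
      · rintro x (⟨j, hj, hx⟩ | ⟨j, hj, hx⟩)
        · rwa [mul_left_cancel (hnc.symm.trans hj)]
        · rw [hcoe, PNat.add_coe, PNat.one_coe] at hj; omega
      · rw [hnc, mulShift_mul]
    · obtain ⟨d, hd⟩ : ∃ d : ℕ+, (d : ℕ) = c + 1 := ⟨c.succPNat, rfl⟩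
      have hnc : n + 1 = 2 * d := (hcoe _ _).2 (by rw [PNat.add_coe, PNat.one_coe]; omega)
      refine (Metric.ediam_mono (t := F d) ?_).trans_lt
        ((hF d).trans_le ?_)
      · rintro x (⟨j, hj, hx⟩ | ⟨j, hj, hx⟩)
        · rw [hcoe] at hj; omega
        · rwa [mul_left_cancel (hnc.symm.trans hj)]
      · refine ENNReal.ofReal_le_ofReal ?_
        rw [← mulShift_mul, ← hnc]
        exact hs.1.antitone (mul_le_mul_right (PNat.lt_add_right n 1).le k)
  · rintro x (hx | hx)
    · obtain ⟨j, hj⟩ := mem_iUnion.1 (hAE hx)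
      exact mem_iUnion.2 ⟨2 * j, Or.inl ⟨j, rfl, hj⟩⟩
    · obtain ⟨j, hj⟩ := mem_iUnion.1 (hBF hx)
      refine mem_iUnion.2 ⟨2 * j - 1, Or.inr ⟨j, ?_, hj⟩⟩
      have := j.pos
      exact PNat.sub_add_of_lt (PNat.coe_lt_coe _ _ |>.1 (by simp; omega))

/-- If `s` is not summable, every set of reals is dominated by the shifts of `s`. -/
theorem isDominated_of_not_summable {s : ℕ+ → ℝ} (hs : s ∈ decSeq) (h : ¬ Summable s) (A : Set ℝ) :
    IsDominated (mulClosure {s}) A := by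
  have hI : IsDominated (mulClosure {s}) (Ici (0 : ℝ)) := by
    rintro _ ⟨_, rfl, k, rfl⟩
    exact exists_fine_cover_Ici (mulShift_mem_decSeq hs k) fun hk =>
      h (summable_of_summable_mul hs.1.antitone (fun n => (hs.2.1 n).le) k hk)
  have hJ : IsDominated (mulClosure {s}) (Iic (0 : ℝ)) := by
    intro t ht
    obtain ⟨E, hE, hc⟩ := hI t ht
    refine ⟨fun n => Neg.neg ⁻¹' E n, fun n => ?_, fun x hx => ?_⟩
    · have : Metric.ediam (Neg.neg ⁻¹' E n) = Metric.ediam (E n) :=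
        (IsometryEquiv.neg ℝ).ediam_preimage (E n)
      rw [this]
      exact hE n
    · obtain ⟨n, hn⟩ := mem_iUnion.1 (hc (mem_Ici.2 (neg_nonneg.2 (mem_Iic.1 hx))))
      exact mem_iUnion.2 ⟨n, hn⟩
  intro t ht
  obtain ⟨E, hE, hc⟩ := hI.union hs hJ t ht
  exact ⟨E, hE, fun x _ => hc (le_total 0 x)⟩

/-- If `s` is summable, the real line is not dominated by `s`. -/
theorem not_isDominated_univ {s : ℕ+ → ℝ} (hs : s ∈ decSeq) (h : Summable s) :
    ¬ IsDominated (mulClosure {s}) (univ : Set ℝ) := by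
  intro hd
  obtain ⟨E, hE, hc⟩ := hd _ (mulShift_mem_mulClosure s 1)
  have : (⊤ : ℝ≥0∞) < ⊤ := calc
    ⊤ = MeasureTheory.volume (univ : Set ℝ) := Real.volume_univ.symm
    _ ≤ ∑' n, MeasureTheory.volume (E n) :=
      (MeasureTheory.measure_mono hc).trans (MeasureTheory.measure_iUnion_le _)
    _ ≤ ∑' n, ENNReal.ofReal (s n) := ENNReal.tsum_le_tsum fun n =>
      (Real.volume_le_diam _).trans (by simpa [mulShift] using (hE n).le)
    _ < ⊤ := by
      rw [← ENNReal.ofReal_tsum_of_nonneg (fun n => (hs.2.1 n).le) h]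
      exact ENNReal.ofReal_lt_top
  exact lt_irrefl _ this

/-! ### Domination of spread sets -/

theorem exists_fine_cover_spread {a : ℕ → ℕ} (ha : UnitSteps a) {β : ℝ} (hβ : 0 < β)
    (hab : ∀ m, (a m : ℝ) ≤ β * m) {t : ℕ+ → ℝ} (ht : t ∈ decSeq)
    (h : ¬ Summable fun n => t n ^ β) :
    ∃ E : ℕ+ → Set ℝ, IsFine t E ∧ spread a '' Ico 0 1 ⊆ ⋃ n, E n := by
  classical
  have hex : ∀ n : ℕ, ∃ m : ℕ, (2⁻¹ : ℝ) ^ m < t n.succPNat := fun n =>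
    exists_pow_lt_of_lt_one (ht.2.1 _) (by norm_num)
  -- By minimality `2 ^ (-m n)` is within a factor `2` of the `n`-th term once that term is at most
  -- `1`, so divergence passes to `∑ 2 ^ (-a (m n))`.
  set m : ℕ → ℕ := fun n => Nat.find (hex n) with hm
  have hmt : ∀ n, ((2 : ℝ) ^ m n)⁻¹ < t n.succPNat := fun n => by
    rw [← inv_pow]; exact Nat.find_spec (hex n)
  have hmono : Monotone m := monotone_nat_of_le_succ fun n => Nat.find_min' _
    ((Nat.find_spec (hex (n + 1))).trans_le
      (ht.1.antitone (Nat.succPNat_le_succPNat.2 n.le_succ)))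
  have hamono : Monotone a := monotone_nat_of_le_succ fun n => by rcases ha n with h | h <;> omega
  have hle : ∀ n, t n.succPNat ≤ 1 → t n.succPNat ≤ 2 * (2⁻¹ : ℝ) ^ m n := by
    intro n hn
    obtain ⟨j, hj⟩ : ∃ j, m n = j + 1 := Nat.exists_eq_succ_of_ne_zero fun h0 => by
      have := hmt n; rw [h0] at this; norm_num at this; linarith
    have := not_lt.1 (Nat.find_min (hex n) (m := j) (by simp only [hm] at hj; omega))
    rw [hj, pow_succ]; linarith
  set u : ℕ → ℝ := fun n => ((2 : ℝ) ^ a (m n))⁻¹ with hu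
  have hns : ¬ Summable u := by
    intro hsum
    apply h
    rw [summable_pnat_iff_summable_succPNat]
    refine Summable.of_norm_bounded_eventually_nat (g := fun n => 2 ^ β * u n) (hsum.mul_left _) ?_
    have hev : ∀ᶠ n : ℕ in atTop, t n.succPNat ≤ 1 := by
      have hsucc : Tendsto Nat.succPNat atTop atTop :=
        tendsto_atTop_mono' _ (Eventually.of_forall fun n => le_rfl)
          (OrderIso.pnatIsoNat.symm.tendsto_atTop)
      exact (hsucc.eventually (ht.2.2.eventually (gt_mem_nhds one_pos))).mono fun n hn => hn.le
    filter_upwards [hev] with n hn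
    have h2 := ht.2.1 n.succPNat
    rw [Real.norm_of_nonneg (by positivity)]
    calc t n.succPNat ^ β ≤ (2 * (2⁻¹ : ℝ) ^ m n) ^ β := by
          exact Real.rpow_le_rpow h2.le (hle n hn) hβ.le
      _ = 2 ^ β * 2 ^ (-(β * m n)) := by
          rw [Real.mul_rpow (by norm_num) (by positivity), inv_pow, ← Real.rpow_natCast,
            ← Real.rpow_neg (by norm_num), ← Real.rpow_mul (by norm_num)]
          congr 2; ring
      _ ≤ 2 ^ β * u n := by
          simp only [hu]
          rw [← Real.rpow_natCast, ← Real.rpow_neg (by norm_num)]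
          gcongr
          · norm_num
          · exact hab _
  set q : ℕ → ℝ := fun n => ∑ i ∈ Finset.range n, u i with hq
  -- Since `a ∘ m` is monotone, each earlier length is an integer multiple of the current one. Laid
  -- end to end from `0`, the intervals are therefore exact dyadic cells, and their spread images
  -- are small.
  have hint : ∀ n, ∃ z : ℤ, (2 : ℝ) ^ a (m n) * q n = z := by
    intro n
    have hi : ∀ i ∈ Finset.range n, (2 : ℝ) ^ a (m n) * u i =
        ((2 ^ (a (m n) - a (m i)) : ℤ) : ℝ) := by
      intro i hi
      have := hamono (hmono (Finset.mem_range.1 hi).le)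
      push_cast
      rw [hu, pow_sub₀ _ (by norm_num) this]
    exact ⟨∑ i ∈ Finset.range n, 2 ^ (a (m n) - a (m i)), by
      rw [hq, Finset.mul_sum, Finset.sum_congr rfl hi]; push_cast; rfl⟩
  refine ⟨fun n => spread a '' Ico (q n.natPred) (q (n.natPred + 1)), fun n => ?_, ?_⟩
  · refine ediam_lt_ofReal (r := ((2 : ℝ) ^ m n.natPred)⁻¹) (ht.2.1 n)
      (by simpa using hmt n.natPred) ?_
    set i := n.natPred
    obtain ⟨z, hz⟩ := hint i
    have hp : (0 : ℝ) < 2 ^ a (m i) := by positivity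
    have hfl : ∀ x ∈ Ico (q i) (q (i + 1)), ⌊(2 : ℝ) ^ a (m i) * x⌋ = z := by
      rintro x ⟨h1, h2⟩
      simp only [hq, Finset.sum_range_succ] at h2
      change x < q i + u i at h2
      rw [Int.floor_eq_iff, ← hz]
      refine ⟨by gcongr, ?_⟩
      have := mul_lt_mul_of_pos_left h2 hp
      rwa [mul_add, mul_inv_cancel₀ hp.ne'] at this
    rintro _ ⟨x, hx, rfl⟩ _ ⟨y, hy, rfl⟩
    exact abs_spread_sub_le ha _ ((hfl x hx).trans (hfl y hy).symm)
  · rintro _ ⟨x, hx, rfl⟩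
    obtain ⟨n, hn⟩ := exists_mem_Ico_sum_range (fun n => by positivity) hns hx.1
    exact mem_iUnion.2 ⟨n.succPNat, x, by simpa using hn, rfl⟩

theorem isDominated_spread {a : ℕ → ℕ} (ha : UnitSteps a) {β : ℝ} (hβ : 0 < β)
    (hab : ∀ m, (a m : ℝ) ≤ β * m) {s : ℕ+ → ℝ} (hs : s ∈ decSeq)
    (h : ¬ Summable fun n => s n ^ β) :
    IsDominated (mulClosure {s}) (spread a '' Ico 0 1) := by
  rintro _ ⟨_, rfl, k, rfl⟩
  refine exists_fine_cover_spread ha hβ hab (mulShift_mem_decSeq hs k) fun hk => h ?_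
  exact summable_of_summable_mul
    (fun m n hmn => Real.rpow_le_rpow (hs.2.1 n).le (hs.1.antitone hmn) hβ.le)
    (fun n => Real.rpow_nonneg (hs.2.1 n).le _) k hk

/-- Pulled back to the line, a cover fine for the shift by `k` has total length at most a tail of `∑
3 * 2 ^ (-a (m n))`. For large `k` this is below `1`, too little for `[0, 1)`. -/
theorem not_isDominated_spread {a : ℕ → ℕ} (ha : UnitSteps a) {s : ℕ+ → ℝ} {m : ℕ+ → ℕ}
    (hm : ∀ᶠ n in atTop, s n ≤ ((2 : ℝ) ^ m n)⁻¹)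
    (h : Summable fun n => ((2 : ℝ) ^ a (m n))⁻¹) :
    ¬ IsDominated (mulClosure {s}) (spread a '' Ico 0 1) := by
  intro hd
  set r : ℕ+ → ℝ≥0∞ := fun n => ENNReal.ofReal (3 * ((2 : ℝ) ^ a (m n))⁻¹) with hr
  have hsum : ∑' n, r n ≠ ⊤ := by
    rw [hr, ← ENNReal.ofReal_tsum_of_nonneg (fun n => by positivity) (h.mul_left 3)]
    exact ENNReal.ofReal_ne_top
  obtain ⟨T, hT⟩ := ((ENNReal.tendsto_tsum_compl_atTop_zero hsum).eventually
    (gt_mem_nhds one_pos)).exists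
  obtain ⟨N, hN⟩ := eventually_atTop.1 hm
  obtain ⟨k, hkN, hkT⟩ : ∃ k : ℕ+, N ≤ k ∧ ∀ n ∈ T, n < k := by
    obtain ⟨M, hM⟩ := T.bddAbove
    exact ⟨max N (M + 1), le_max_left _ _, fun n hn =>
      (PNat.lt_add_one_iff.2 (hM hn)).trans_le (le_max_right _ _)⟩
  -- All indices `k * n` thus lie beyond both `N` and the finite set `T`.
  have hle : ∀ n : ℕ+, k ≤ k * n := fun n => le_mul_of_one_le_right' one_le
  obtain ⟨E, hE, hc⟩ := hd _ (mulShift_mem_mulClosure s k)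
  have hvol : ∀ n, MeasureTheory.volume (spread a ⁻¹' E n) ≤ r (k * n) := by
    intro n
    refine (Real.volume_le_diam _).trans (Metric.ediam_le fun x hx y hy => ?_)
    rw [edist_dist, Real.dist_eq]
    refine ENNReal.ofReal_le_ofReal (abs_sub_le_of_abs_spread_sub_le ha _ ?_)
    have h1 := (Metric.edist_le_ediam_of_mem (mem_preimage.1 hx) (mem_preimage.1 hy)).trans_lt (hE n)
    rw [edist_dist, Real.dist_eq] at h1
    exact (ENNReal.ofReal_lt_ofReal_iff'.1 h1).1.le.trans (hN (k * n) (hkN.trans (hle n)))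
  have : (1 : ℝ≥0∞) < 1 := calc
    1 = MeasureTheory.volume (Ico (0 : ℝ) 1) := by simp
    _ ≤ MeasureTheory.volume (⋃ n, spread a ⁻¹' E n) := MeasureTheory.measure_mono fun x hx => by
        simpa using hc ⟨x, hx, rfl⟩
    _ ≤ ∑' n, MeasureTheory.volume (spread a ⁻¹' E n) := MeasureTheory.measure_iUnion_le _
    _ ≤ ∑' n, r (k * n) := ENNReal.tsum_le_tsum hvol
    _ ≤ ∑' n : {n // n ∉ T}, r n :=
        ENNReal.tsum_comp_le_tsum_of_injective
          (f := fun n => (⟨k * n, fun hn => (hkT _ hn).not_ge (hle n)⟩ : {n // n ∉ T}))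
          (fun i j hij => mul_left_cancel (Subtype.ext_iff.1 hij)) fun n => r n
    _ < 1 := hT
  exact lt_irrefl _ this

/-! ### Diagonal choice of the growth rate -/

/-- Countably many summability conditions on `2 ^ (-β j * m n)` are simultaneously met by one
unit-step sequence growing, for each `j`, at most like `β j * m`. -/
theorem exists_unitSteps_summable {ι : Type*} (m : ι → ℕ) {β : ℕ → ℝ} (h0 : ∀ j, 0 ≤ β j)
    (h1 : ∀ j, β j ≤ 1) (h : ∀ j, Summable fun n => (2 : ℝ) ^ (-(β j * m n))) :
    ∃ a : ℕ → ℕ, UnitSteps a ∧ (∀ j, ∃ C : ℝ, ∀ i : ℕ, (a i : ℝ) ≤ β j * i + C) ∧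
      Summable fun n => ((2 : ℝ) ^ a (m n))⁻¹ := by
  -- Dividing by `D j` bounds the `j`-th sum over `n` by `2 ^ (-j)`, so the mixture `W` of all the
  -- exponentials is still summable along `m`. The summand `1` keeps `D j ≥ 1`. The sequence `a` is
  -- built so that `2 ^ (-a i)` is comparable to `W i`.
  set D : ℕ → ℝ := fun j => 1 + ∑' n, (2 : ℝ) ^ (-(β j * m n)) with hD
  have hD1 : ∀ j, 1 ≤ D j := fun j =>
    le_add_of_nonneg_right (tsum_nonneg fun n => by positivity)
  have hDpos : ∀ j, 0 < D j := fun j => one_pos.trans_le (hD1 j)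
  set g : ℕ → ℕ → ℝ := fun j i => (1 / 2) ^ j * (2 : ℝ) ^ (-(β j * i)) / D j with hg
  have hgpos : ∀ j i, 0 < g j i := fun j i => by have := hDpos j; positivity
  have hgle : ∀ j i, g j i ≤ (1 / 2) ^ j := by
    intro j i
    rw [hg, div_le_iff₀ (hDpos j)]
    have : (2 : ℝ) ^ (-(β j * i)) ≤ 1 :=
      Real.rpow_le_one_of_one_le_of_nonpos (by norm_num)
        (by have := mul_nonneg (h0 j) (Nat.cast_nonneg i); linarith)
    exact mul_le_mul_of_nonneg_left (this.trans (hD1 j)) (by positivity)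
  have hgs : ∀ i, Summable fun j => g j i := fun i =>
    Summable.of_nonneg_of_le (fun j => (hgpos j i).le) (fun j => hgle j i) summable_geometric_two
  have hstep : ∀ j i, g j (i + 1) = g j i * 2 ^ (-β j) := by
    intro j i
    have : (2 : ℝ) ^ (-(β j * ((i + 1 : ℕ) : ℝ))) = 2 ^ (-(β j * i)) * 2 ^ (-β j) := by
      rw [← Real.rpow_add (by norm_num)]; congr 1; push_cast; ring
    simp only [hg, this]; ring
  set W : ℕ → ℝ := fun i => ∑' j, g j i with hW
  have hgW : ∀ j i, g j i ≤ W i := fun j i => (hgs i).le_tsum j fun k _ => (hgpos k i).le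
  have hWpos : ∀ i, 0 < W i := fun i => (hgpos 0 i).trans_le (hgW 0 i)
  have hW0 : W 0 ≤ 2 := by
    rw [← tsum_geometric_two]
    exact (hgs 0).tsum_le_tsum (fun j => hgle j 0) summable_geometric_two
  have hWanti : ∀ i, W (i + 1) ≤ W i := fun i =>
    (hgs (i + 1)).tsum_le_tsum (fun j => by
      rw [hstep]
      exact mul_le_of_le_one_right (hgpos j i).le
        (Real.rpow_le_one_of_one_le_of_nonpos (by norm_num) (by linarith [h0 j]))) (hgs i)
  -- As `β j ≤ 1`, no term falls by more than half; this bounds the steps of `-logb 2 (W i)` by `1`.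
  have hWhalf : ∀ i, W i / 2 ≤ W (i + 1) := fun i => by
    rw [hW, ← tsum_div_const]
    refine ((hgs i).div_const 2).tsum_le_tsum (fun j => ?_) (hgs (i + 1))
    rw [hstep, div_eq_mul_inv, ← Real.rpow_neg_one]
    exact mul_le_mul_of_nonneg_left
      (Real.rpow_le_rpow_of_exponent_le (by norm_num) (by linarith [h1 j])) (hgpos j i).le
  have hgm : ∀ j, Summable fun n => g j (m n) := fun j => ((h j).mul_left _).div_const _
  have hgm_le : ∀ j, ∑' n, g j (m n) ≤ (1 / 2) ^ j := fun j => by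
    simp only [hg]
    rw [tsum_div_const, tsum_mul_left, div_le_iff₀ (hDpos j)]
    exact mul_le_mul_of_nonneg_left (le_add_of_nonneg_left zero_le_one) (by positivity)
  have hWsum : Summable fun n => W (m n) := by
    have hpr : Summable fun p : ℕ × ι => g p.1 (m p.2) := by
      rw [summable_prod_of_nonneg fun p => (hgpos p.1 (m p.2)).le]
      exact ⟨hgm, Summable.of_nonneg_of_le (fun j => tsum_nonneg fun n => (hgpos j (m n)).le)
        hgm_le summable_geometric_two⟩
    exact hpr.prod_symm.prod
  -- The `1` serves twice: it makes `b 0` nonnegative, as `W 0 ≤ 2`, and it offsets the loss from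
  -- the floor, so that `2 ^ (-⌊b i⌋₊) ≤ W i`.
  set b : ℕ → ℝ := fun i => 1 - Real.logb 2 (W i) with hb
  have hbmono : ∀ i, b i ≤ b (i + 1) := fun i =>
    sub_le_sub_left (Real.logb_le_logb_of_le (by norm_num) (hWpos _) (hWanti i)) 1
  have hb0 : 0 ≤ b 0 := by
    have := Real.logb_le_logb_of_le (b := 2) (by norm_num) (hWpos 0) hW0
    rw [Real.logb_self_eq_one (by norm_num)] at this
    exact sub_nonneg.2 this
  refine ⟨fun i => ⌊b i⌋₊, unitSteps_floor hb0 hbmono fun i => ?_, fun j => ?_, ?_⟩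
  · have := Real.logb_le_logb_of_le (b := 2) (by norm_num) (half_pos (hWpos i)) (hWhalf i)
    rw [Real.logb_div (hWpos i).ne' (by norm_num), Real.logb_self_eq_one (by norm_num)] at this
    simp only [hb]; linarith
  · refine ⟨1 + j + Real.logb 2 (D j), fun i => ?_⟩
    refine (Nat.floor_le (hb0.trans (monotone_nat_of_le_succ hbmono i.zero_le))).trans ?_
    have := Real.logb_le_logb_of_le (b := 2) (by norm_num) (hgpos j i) (hgW j i)
    have e : Real.logb 2 (g j i) = -j - β j * i - Real.logb 2 (D j) := by
      simp only [hg]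
      rw [Real.logb_div (by positivity) (hDpos j).ne', Real.logb_mul (by positivity) (by positivity),
        Real.logb_rpow (by norm_num) (by norm_num), Real.logb_pow, one_div, Real.logb_inv,
        Real.logb_self_eq_one (by norm_num)]
      ring
    simp only [hb]; linarith
  · refine Summable.of_nonneg_of_le (fun n => by positivity) (fun n => ?_) hWsum
    rw [← Real.rpow_natCast, ← Real.rpow_neg (by norm_num)]
    refine le_of_le_of_eq ?_ (Real.rpow_logb (b := 2) (by norm_num) (by norm_num) (hWpos (m n)))
    refine Real.rpow_le_rpow_of_exponent_le (by norm_num) ?_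
    have := Nat.lt_floor_add_one (b (m n))
    simp only [hb] at this ⊢
    linarith

/-! ### The separating sets -/

theorem exists_dominated_dimH_gt {s : ℕ+ → ℝ} (hs : s ∈ decSeq) {β : ℝ≥0} (hβ : 0 < β)
    (hβ1 : β ≤ 1) (h : ¬ Summable fun n => s n ^ (β : ℝ)) :
    ∃ A : Set ℝ, IsDominated (mulClosure {s}) A ∧ (β : ℝ≥0∞) ≤ dimH A := by
  have hβ' : (β : ℝ) ≤ 1 := hβ1
  have hu : UnitSteps fun m => ⌊(β : ℝ) * m⌋₊ :=
    unitSteps_floor (b := fun m : ℕ => (β : ℝ) * m) (by simp)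
      (fun m => by push_cast; linarith [β.coe_nonneg]) (fun m => by push_cast; linarith)
  exact ⟨_, isDominated_spread hu hβ (fun m => Nat.floor_le (by positivity)) hs h,
    le_dimH_spread hu (by simp) hβ fun m => (Nat.lt_floor_add_one _).le⟩

theorem exists_dimH_le_not_dominated {s : ℕ+ → ℝ} (hs : s ∈ decSeq) {α : ℝ≥0} (hα : α < 1)
    (h : ∀ β : ℝ≥0, α < β → β ≤ 1 → Summable fun n => s n ^ (β : ℝ)) :
    ∃ A : Set ℝ, dimH A ≤ α ∧ ¬ IsDominated (mulClosure {s}) A := by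
  -- The upper bound on `2 ^ (-m)` carries over summability; the lower bound, needed only
  -- eventually, serves non-domination. Terms above `1` get the default `m = 0`.
  have hm : ∀ n, ∃ m : ℕ, ((2 : ℝ) ^ m)⁻¹ ≤ 2 * s n ∧ (s n ≤ 1 → s n ≤ ((2 : ℝ) ^ m)⁻¹) := by
    intro n
    rcases le_or_gt (s n) 1 with h1 | h1
    · obtain ⟨m, hm1, hm2⟩ := exists_nat_pow_near_of_lt_one (hs.2.1 n) h1 (y := (2 : ℝ)⁻¹)
        (by norm_num) (by norm_num)
      rw [inv_pow] at hm1 hm2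
      rw [pow_succ, mul_inv] at hm1
      exact ⟨m, by linarith, fun _ => hm2⟩
    · exact ⟨0, by norm_num; linarith, fun h => absurd h h1.not_ge⟩
  choose m hm1 hm2 using hm
  -- Exponents in `(α, 1]` tending to `α`, so that the growth bounds for all `j` give dimension at
  -- most `α`.
  set β : ℕ → ℝ≥0 := fun j => α + (1 - α) / (j + 1) with hβ
  have hpos : 0 < 1 - α := tsub_pos_of_lt hα
  have hαβ : ∀ j, α < β j := fun j => lt_add_of_pos_right _ (by positivity)
  have hβ1 : ∀ j, β j ≤ 1 := fun j => by
    have : (1 - α) / ((j : ℝ≥0) + 1) ≤ 1 - α := div_le_self hpos.le (by simp)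
    calc β j ≤ α + (1 - α) := by simp only [hβ]; gcongr
      _ = 1 := add_tsub_cancel_of_le hα.le
  have hβlim : Tendsto β atTop (𝓝 α) := by
    have : Tendsto (fun j : ℕ => (1 - α) / ((j : ℝ≥0) + 1)) atTop (𝓝 0) := by
      simpa [div_eq_mul_inv] using
        (tendsto_one_div_add_atTop_nhds_zero_nat (𝕜 := ℝ≥0)).const_mul (1 - α)
    simpa using this.const_add α
  obtain ⟨a, ha, hgrow, hsum⟩ := exists_unitSteps_summable m (β := fun j => β j)
    (fun j => (β j).coe_nonneg) (fun j => hβ1 j) fun j => by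
      refine Summable.of_nonneg_of_le (fun n => by positivity) (fun n => ?_)
        ((h (β j) (hαβ j) (hβ1 j)).mul_left (2 ^ (β j : ℝ)))
      rw [← Real.mul_rpow (by norm_num) (hs.2.1 n).le]
      refine le_trans (le_of_eq ?_) (Real.rpow_le_rpow (by positivity) (hm1 n) (β j).coe_nonneg)
      rw [← Real.rpow_natCast, ← Real.rpow_neg (by norm_num), ← Real.rpow_mul (by norm_num)]
      congr 1; ring
  refine ⟨spread a '' Ico 0 1, ?_, not_isDominated_spread ha ?_ hsum⟩
  · refine ENNReal.le_of_forall_pos_le_add fun ε hε _ => ?_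
    obtain ⟨j, hj⟩ := (hβlim.eventually (gt_mem_nhds (lt_add_of_pos_right α hε))).exists
    obtain ⟨C, hC⟩ := hgrow j
    rw [← ENNReal.coe_add]
    exact dimH_spread_le ha (δ := β j) (NNReal.coe_lt_coe.2 hj) hC
  · exact (hs.2.2.eventually (gt_mem_nhds one_pos)).mono fun n hn => hm2 n hn.le

end Dominated

theorem mainTheorem7 :
    (∀ s ∈ Dominated.decSeq, ∀ α : ℝ≥0, α < 1 →
      Dominated.hausdorffDimLE α ≠ Dominated.dominatedSets ℝ (Dominated.mulClosure {s})) ∧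
    (∀ s ∈ Dominated.decSeq,
      (Dominated.hausdorffDimLE 1 ≠ Dominated.dominatedSets ℝ (Dominated.mulClosure {s}) ↔
        Memℓp s 1)) := by
  refine ⟨fun s hs α hα heq => ?_, fun s hs => ?_⟩
  · by_cases h : ∀ β : ℝ≥0, α < β → β ≤ 1 → Summable fun n => s n ^ (β : ℝ)
    · obtain ⟨A, hA, hA'⟩ := Dominated.exists_dimH_le_not_dominated hs hα h
      exact hA' (heq.subset hA)
    · push Not at h
      obtain ⟨β, hαβ, hβ1, hβ⟩ := h
      obtain ⟨A, hA, hA'⟩ := Dominated.exists_dominated_dimH_gt hs (pos_of_gt hαβ) hβ1 hβ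
      exact (hA'.trans (heq.superset hA)).not_gt (ENNReal.coe_lt_coe.2 hαβ)
  · have hmem : Memℓp s 1 ↔ Summable s := by
      rw [memℓp_gen_iff (by simp)]
      simp [abs_of_pos (hs.2.1 _)]
    have hdim : ∀ A : Set ℝ, A ∈ Dominated.hausdorffDimLE 1 := fun A =>
      (dimH_mono (subset_univ A)).trans (by simp [Real.dimH_univ])
    rw [hmem]
    constructor
    · intro hne
      by_contra hns
      exact hne (Set.ext fun A =>
        ⟨fun _ => Dominated.isDominated_of_not_summable hs hns A, fun _ => hdim A⟩)
    · exact fun hsum heq => Dominated.not_isDominated_univ hs hsum (heq.subset (hdim univ))
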